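/- All rings are commutative. For a noetherian local ring $R$ with maximal ideal $\mathfrak m$ and a finitely generated $R$-module $M$ with minimal free resolution $F$, filter $F$ by the subcomplexes $\mathcal G^nF$ with $(\mathcal G^nF)_i=\mathfrak m^{n-i}F_i$ (where $\mathfrak m^j=R$ for $j\le 0$), and let $\operatorname{lin}^RF$ be the associated graded complex $\bigoplus_n \mathcal G^nF/\mathcal G^{n+1}F$. The linearity defect of $M$ is $\operatorname{lind}_RM=\sup\{i: H_i(\operatorname{lin}^RF)\ne 0\}\in\mathbb N\cup\{\infty\}$, with $\operatorname{lind}_R 0=0$; $M$ is a Koszul module if $\operatorname{lind}_RM=0$. Put $\operatorname{glind} R=\sup\{\operatorname{lind}_RM : M \text{ a finitely generated } R\text{-module}\}$, and call $R$ absolutely Koszul if $\operatorname{lind}_RM<\infty$ for every finitely generated $R$-module $M$. **Theorem.** Let $R\to S$ be a surjective homomorphism of noetherian local rings such that $\operatorname{lind}_RS=0$, that is, $S$ is a Koszul $R$-module. Then $\operatorname{lind}_RN=\operatorname{lind}_SN$ for every finitely generated $S$-module $N$. In particular, $\operatorname{glind} S\le\operatorname{glind} R$; and if $R$ is absolutely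 Koszul, then so is $S$. -/

import Mathlib

open IsLocalRing

namespace LinearityDefect

universe u v

/-- A minimal free resolution `⋯ ⟶ F₁ ⟶ F₀ ⟶ M ⟶ 0` of a module `M` over a local ring `R`,
with finitely generated free modules `F i = R ^ (rank i)`: it is exact, and the differential
maps `F (i + 1)` into `𝔪 F i`. -/
structure MinimalFreeResolution (R : Type u) [CommRing R] [IsLocalRing R]
    (M : Type v) [AddCommGroup M] [Module R M] where
  /-- the Betti numbers -/
  rank : ℕ → ℕ
  /-- the differential `F (i + 1) ⟶ F i` -/
  d (i : ℕ) : (Fin (rank (i + 1)) → R) →ₗ[R] (Fin (rank i) → R)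
  /-- the augmentation `F 0 ⟶ M` -/
  aug : (Fin (rank 0) → R) →ₗ[R] M
  aug_surjective : Function.Surjective aug
  exact_zero : Function.Exact (d 0) aug
  exact_succ (i : ℕ) : Function.Exact (d (i + 1)) (d i)
  minimal (i : ℕ) :
    LinearMap.range (d i) ≤ maximalIdeal R • (⊤ : Submodule R (Fin (rank i) → R))

namespace MinimalFreeResolution

variable {R : Type u} [CommRing R] [IsLocalRing R] {M : Type v} [AddCommGroup M] [Module R M]
  (F : MinimalFreeResolution R M)

/-- The filtration `(𝓖ⁿ F)ᵢ = 𝔪 ^ (n - i) Fᵢ`, where `𝔪 ^ j = R` for `j ≤ 0` (this is what the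
truncated subtraction gives). Negative `n` are not needed, since `(𝓖ⁿ F)ᵢ = Fᵢ` for `n ≤ i`. -/
def filtration (n i : ℕ) : Submodule R (Fin (F.rank i) → R) :=
  maximalIdeal R ^ (n - i) • ⊤

/-- The differential respects the filtration. -/
theorem d_mem_filtration (n i : ℕ) (x : Fin (F.rank (i + 1)) → R)
    (hx : x ∈ F.filtration n (i + 1)) : F.d i x ∈ F.filtration n i := by
  have h1 : F.d i x ∈ (F.filtration n (i + 1)).map (F.d i) := Submodule.mem_map_of_mem hx
  rw [filtration, Submodule.map_smul'', Submodule.map_top] at h1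
  have h2 := (smul_mono_right (maximalIdeal R ^ (n - (i + 1))) (F.minimal i)) h1
  rw [← mul_smul, ← pow_succ] at h2
  exact Submodule.smul_mono_left (Ideal.pow_le_pow_right (by omega)) h2

/-- The component `(𝓖ⁿ F)ᵢ / (𝓖ⁿ⁺¹ F)ᵢ` of the associated graded complex. -/
def gr (n i : ℕ) : Type u :=
  F.filtration n i ⧸ (F.filtration (n + 1) i).submoduleOf (F.filtration n i)

instance (n i : ℕ) : AddCommGroup (F.gr n i) :=
  inferInstanceAs (AddCommGroup
    (F.filtration n i ⧸ (F.filtration (n + 1) i).submoduleOf (F.filtration n i)))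

instance (n i : ℕ) : Module R (F.gr n i) :=
  inferInstanceAs (Module R
    (F.filtration n i ⧸ (F.filtration (n + 1) i).submoduleOf (F.filtration n i)))

/-- The map `(𝓖ⁿ F)ᵢ₊₁ / (𝓖ⁿ⁺¹ F)ᵢ₊₁ ⟶ (𝓖ⁿ F)ᵢ / (𝓖ⁿ⁺¹ F)ᵢ` induced by the differential. -/
def grD (n i : ℕ) : F.gr n (i + 1) →ₗ[R] F.gr n i :=
  Submodule.mapQ ((F.filtration (n + 1) (i + 1)).submoduleOf (F.filtration n (i + 1)))
    ((F.filtration (n + 1) i).submoduleOf (F.filtration n i))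
    ((F.d i).restrict (F.d_mem_filtration n i))
    (fun x hx => F.d_mem_filtration (n + 1) i x hx)

/-- The term in homological degree `i` of the linear part of `F`, that is, of the associated
graded complex of the filtration `𝓖`. -/
abbrev linPart (i : ℕ) : Type u := DirectSum ℕ (fun n => F.gr n i)

/-- The differential of the linear part of `F`. -/
def linD (i : ℕ) : F.linPart (i + 1) →ₗ[R] F.linPart i :=
  DirectSum.lmap (fun n => F.grD n i)

/-- The cycles in homological degree `i` of the linear part of `F`. -/
def linCycles : (i : ℕ) → Submodule R (F.linPart i)
  | 0 => ⊤
  | i + 1 => LinearMap.ker (F.linD i)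

/-- The boundaries in homological degree `i` of the linear part of `F`. -/
def linBoundaries (i : ℕ) : Submodule R (F.linPart i) := LinearMap.range (F.linD i)

/-- The linear part of `F` is a complex. -/
theorem linBoundaries_le_linCycles (i : ℕ) : F.linBoundaries i ≤ F.linCycles i := by
  cases i with
  | zero => exact le_top
  | succ i =>
    rintro _ ⟨x, rfl⟩
    change F.linD i (F.linD (i + 1) x) = 0
    ext n : 1
    simp only [linD, DirectSum.lmap_apply, DirectSum.zero_apply]
    obtain ⟨y, hy⟩ := Submodule.Quotient.mk_surjective _ (x n)
    rw [← hy]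
    refine (Submodule.Quotient.mk_eq_zero _).2 ?_
    change F.d i (F.d (i + 1) y) ∈ F.filtration (n + 1) i
    rw [(F.exact_succ i).apply_apply_eq_zero]
    exact zero_mem _

/-- The homology module `Hᵢ` of the linear part of `F`. -/
abbrev linHomology (i : ℕ) : Type u :=
  F.linCycles i ⧸ (F.linBoundaries i).submoduleOf (F.linCycles i)

end MinimalFreeResolution

/-- Every finitely generated module over a local ring has a minimal free cover. -/
theorem exists_minimal_cover (R : Type u) [CommRing R] [IsLocalRing R]
    (M : Type v) [AddCommGroup M] [Module R M] [Module.Finite R M] :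
    ∃ (b : ℕ) (p : (Fin b → R) →ₗ[R] M), Function.Surjective p ∧
      LinearMap.ker p ≤ maximalIdeal R • (⊤ : Submodule R (Fin b → R)) := by
  classical
  have hex : ∃ b : ℕ, ∃ v : Fin b → M, Submodule.span R (Set.range v) = ⊤ := by
    obtain ⟨n, s, hs⟩ := Module.Finite.exists_fin (R := R) (M := M)
    exact ⟨n, s, hs⟩
  obtain ⟨v, hv⟩ := Nat.find_spec hex
  have hmin := fun m => Nat.find_min hex (m := m)
  generalize Nat.find hex = b at v hv hmin
  refine ⟨b, Fintype.linearCombination R v, ?_, ?_⟩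
  · rw [← LinearMap.range_eq_top, Fintype.range_linearCombination, hv]
  · intro x hx
    have hcoord : ∀ j, x j ∈ maximalIdeal R := by
      intro j
      by_contra hj
      have hu : IsUnit (x j) := by simpa using hj
      obtain _ | c := b
      · exact j.elim0
      · refine hmin c (Nat.lt_succ_self c) ⟨fun i => v (j.succAbove i), ?_⟩
        rw [eq_top_iff, ← hv, Submodule.span_le]
        have hsub : ∀ i, v (j.succAbove i) ∈
            Submodule.span R (Set.range fun i => v (j.succAbove i)) :=
          fun i => Submodule.subset_span ⟨i, rfl⟩
        rintro _ ⟨i, rfl⟩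
        rcases Fin.eq_self_or_eq_succAbove j i with rfl | ⟨k, rfl⟩
        · rw [LinearMap.mem_ker, Fintype.linearCombination_apply, Fin.sum_univ_succAbove _ i,
            add_eq_zero_iff_eq_neg] at hx
          have h1 : x i • v i ∈ Submodule.span R (Set.range fun k => v (i.succAbove k)) := by
            rw [hx]
            exact neg_mem (sum_mem fun k _ => Submodule.smul_mem _ _ (hsub k))
          exact (Submodule.smul_mem_iff_of_isUnit _ hu).1 h1
        · exact hsub k
    rw [pi_eq_sum_univ' x]
    exact sum_mem fun i _ => Submodule.smul_mem_smul (hcoord i) trivial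

/-- Every finitely generated module over a noetherian local ring has a minimal free resolution. -/
theorem nonempty_minimalFreeResolution (R : Type u) [CommRing R] [IsLocalRing R]
    [IsNoetherianRing R] (M : Type v) [AddCommGroup M] [Module R M] [Module.Finite R M] :
    Nonempty (MinimalFreeResolution R M) := by
  choose b p hp hker using fun s : Σ b : ℕ, Submodule R (Fin b → R) =>
    exists_minimal_cover R s.2
  obtain ⟨b₀, p₀, hp₀, hker₀⟩ := exists_minimal_cover R M
  let s : ℕ → Σ b : ℕ, Submodule R (Fin b → R) := fun n =>
    Nat.rec ⟨b₀, LinearMap.ker p₀⟩ (fun _ t => ⟨b t, LinearMap.ker (p t)⟩) n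
  have hs : ∀ n, (s n).2 ≤ maximalIdeal R • (⊤ : Submodule R (Fin (s n).1 → R)) := by
    intro n
    cases n with
    | zero => exact hker₀
    | succ n => exact hker (s n)
  have hr : ∀ n, LinearMap.range ((s n).2.subtype ∘ₗ p (s n)) = (s n).2 := by
    intro n
    rw [LinearMap.range_comp, LinearMap.range_eq_top.2 (hp (s n)), Submodule.map_top,
      Submodule.range_subtype]
  exact ⟨{
    rank := fun n => (s n).1
    d := fun n => (s n).2.subtype ∘ₗ p (s n)
    aug := p₀
    aug_surjective := hp₀
    exact_zero := LinearMap.exact_iff.2 (hr 0).symm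
    exact_succ := fun n => LinearMap.exact_iff.2 <| by
      refine Eq.trans ?_ (hr (n + 1)).symm
      rw [LinearMap.ker_comp, Submodule.ker_subtype, Submodule.comap_bot]
    minimal := fun n => (hr n).trans_le (hs n) }⟩

/-- The linearity defect of `M`: the supremum of the `i` such that `Hᵢ` of the linear part of the
minimal free resolution of `M` is nonzero. Minimal free resolutions are unique up to isomorphism,
so any of them may be used. The supremum is taken in `ℕ∞`, and is `0` for `M = 0`. -/
noncomputable def lind (R : Type u) [CommRing R] [IsLocalRing R]
    (M : Type v) [AddCommGroup M] [Module R M] : ℕ∞ :=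
  sSup {t : ℕ∞ | ∃ (F : MinimalFreeResolution R M) (i : ℕ),
    Nontrivial (F.linHomology i) ∧ t = (i : ℕ∞)}

/-- The global linearity defect of `R`: the supremum of the linearity defects of the finitely
generated `R`-modules (up to isomorphism these all live in the universe of `R`). -/
noncomputable def glind (R : Type u) [CommRing R] [IsLocalRing R] : ℕ∞ :=
  sSup {t : ℕ∞ | ∃ M : ModuleCat.{u} R, Module.Finite R M ∧ t = lind R M}

/-- `R` is absolutely Koszul if every finitely generated `R`-module has finite linearity
defect. -/
def IsAbsolutelyKoszul (R : Type u) [CommRing R] [IsLocalRing R] : Prop :=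
  ∀ (M : Type u) [AddCommGroup M] [Module R M], Module.Finite R M → lind R M < ⊤

end LinearityDefect

/- The linear part of `F` has no homology in degrees `> d` exactly when the differentials out of
degrees `> d` are strict for the filtration `𝓖`, that is, when the syzygy `Ω = im (F (j + 1) ⟶ F j)`
satisfies the Artin–Rees condition `Ω ∩ 𝔪 ^ (q + 1) F j ⊆ 𝔪 ^ q Ω` for all `q` and all `j ≥ d`. If
`S` is a Koszul `R`-module, the kernel of a minimal cover `R ^ b ⟶ S ^ b ⟶ N` is an extension of
the `S`-syzygy of `N` by a syzygy of `S ^ b`, which is again Koszul. This extension is strict for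
the `𝔪`-adic filtrations, so that its middle and right terms satisfy the Artin–Rees condition in
the same degrees, and the conditions over `R` and over `S` can be compared by dimension shifting. -/

namespace LinearityDefect

universe u v w

section ArtinRees

variable {R : Type*} [CommRing R] {I : Ideal R} {P Q : Type*} [AddCommGroup P] [Module R P]
  [AddCommGroup Q] [Module R Q]

theorem map_smul_top_of_surjective {f : P →ₗ[R] Q} (hf : Function.Surjective f) :
    (I • ⊤ : Submodule R P).map f = I • ⊤ := by
  rw [Submodule.map_smul'', Submodule.map_top, LinearMap.range_eq_top.2 hf]

theorem mk_mem_smul_top {x : P} {y : Q} (hx : x ∈ I • (⊤ : Submodule R P))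
    (hy : y ∈ I • (⊤ : Submodule R Q)) : (x, y) ∈ I • (⊤ : Submodule R (P × Q)) := by
  have hx' : (x, (0 : Q)) ∈ I • (⊤ : Submodule R (P × Q)) :=
    Submodule.smul_top_le_comap_smul_top I (LinearMap.inl R P Q) hx
  have hy' : ((0 : P), y) ∈ I • (⊤ : Submodule R (P × Q)) :=
    Submodule.smul_top_le_comap_smul_top I (LinearMap.inr R P Q) hy
  simpa using add_mem hx' hy'

theorem pow_smul_le_pow_succ_smul_top {K : Submodule R P} (hK : K ≤ I • ⊤) (q : ℕ) :
    I ^ q • K ≤ I ^ (q + 1) • ⊤ := by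
  rw [pow_succ, mul_smul]
  exact smul_mono_right _ hK

/-- The Artin–Rees condition `K ∩ I ^ (q + 1) P ⊆ I ^ q K` for all `q`. If `P` is a free cover of
`M` with kernel `K`, it says that `Tor₁ (R ⧸ I ^ (q + 1), M) ⟶ Tor₁ (R ⧸ I ^ q, M)` vanishes for
all `q`. -/
def HasArtinReesOne (I : Ideal R) (K : Submodule R P) : Prop :=
  ∀ q : ℕ, K ⊓ I ^ (q + 1) • ⊤ ≤ I ^ q • K

theorem HasArtinReesOne.map_of_comp_eq_id {K : Submodule R P} (hK : HasArtinReesOne I K)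
    {f : P →ₗ[R] Q} {s : Q →ₗ[R] P} (hs : s ∘ₗ f = LinearMap.id) :
    HasArtinReesOne I (K.map f) := by
  rintro q _ ⟨⟨x, hx, rfl⟩, hfx⟩
  have hsfx : s (f x) = x := LinearMap.congr_fun hs x
  have hxq : x ∈ I ^ (q + 1) • (⊤ : Submodule R P) :=
    hsfx ▸ Submodule.smul_top_le_comap_smul_top _ s hfx
  rw [← Submodule.map_smul'']
  exact Submodule.mem_map_of_mem (hK q ⟨hx, hxq⟩)

theorem hasArtinReesOne_map_iff {K : Submodule R P} {f : P →ₗ[R] Q} (hK : K ≤ I • ⊤)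
    (hker : HasArtinReesOne I (K ⊓ LinearMap.ker f))
    (hlift : ∀ q : ℕ, K.map f ⊓ I ^ (q + 1) • ⊤ ≤ (K ⊓ I ^ (q + 1) • ⊤).map f) :
    HasArtinReesOne I (K.map f) ↔ HasArtinReesOne I K := by
  constructor
  · rintro h q x ⟨hx, hxq⟩
    have hfx : f x ∈ (I ^ q • K).map f := by
      rw [Submodule.map_smul'']
      exact h q ⟨Submodule.mem_map_of_mem hx, Submodule.smul_top_le_comap_smul_top _ f hxq⟩
    obtain ⟨z, hz, hzx⟩ := hfx
    have hxz : x - z ∈ I ^ q • (K ⊓ LinearMap.ker f) := hker q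
      ⟨⟨sub_mem hx (Submodule.smul_le_right hz), by simp [hzx]⟩,
        sub_mem hxq (pow_smul_le_pow_succ_smul_top hK q hz)⟩
    have hxz' : x - z ∈ I ^ q • K :=
      (smul_mono_right (I ^ q) (inf_le_left : K ⊓ LinearMap.ker f ≤ K)) hxz
    simpa using add_mem hxz' hz
  · intro h q
    exact (hlift q).trans ((Submodule.map_mono (h q)).trans (Submodule.map_smul'' _ _ _).le)

theorem hasArtinReesOne_restrictScalars_iff {S : Type*} [CommRing S] [Algebra R S] [Module S P]
    [IsScalarTower R S P] {K : Submodule S P} :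
    HasArtinReesOne I (K.restrictScalars R) ↔ HasArtinReesOne (I.map (algebraMap R S)) K := by
  refine forall_congr' fun q => ?_
  rw [← Submodule.restrictScalars_top R S P, ← Ideal.smul_restrictScalars,
    ← Ideal.smul_restrictScalars, Ideal.map_pow, Ideal.map_pow]
  rfl

end ArtinRees

section MinimalCover

variable {R : Type*} [CommRing R] {I : Ideal R} {P Q M N : Type*} [AddCommGroup P] [Module R P]
  [AddCommGroup Q] [Module R Q] [AddCommGroup M] [Module R M] [AddCommGroup N] [Module R N]

/-- A surjection whose kernel is contained in `I P`. For finitely generated projective `P` over a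
local ring with maximal ideal `I`, this is a minimal free cover. -/
def IsMinimalCover (I : Ideal R) (p : P →ₗ[R] M) : Prop :=
  Function.Surjective p ∧ LinearMap.ker p ≤ I • (⊤ : Submodule R P)

theorem IsMinimalCover.comap_smul_top {p : P →ₗ[R] M} (hp : IsMinimalCover I p) :
    (I • ⊤ : Submodule R M).comap p = I • ⊤ := by
  rw [Submodule.comap_smul_top_of_surjective I p hp.1, sup_eq_left.2 hp.2]

theorem IsMinimalCover.comp {π : P →ₗ[R] Q} {p : Q →ₗ[R] N} (hp : IsMinimalCover I p)
    (hπ : IsMinimalCover I π) : IsMinimalCover I (p ∘ₗ π) := by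
  refine ⟨hp.1.comp hπ.1, ?_⟩
  rw [LinearMap.ker_comp, ← hπ.comap_smul_top]
  exact Submodule.comap_mono hp.2

theorem IsMinimalCover.compLeft {p : P →ₗ[R] M} (hp : IsMinimalCover I p) (ι : Type*) [Finite ι] :
    IsMinimalCover I (p.compLeft ι) := by
  classical
  have := Fintype.ofFinite ι
  refine ⟨hp.1.comp_left, fun x hx => ?_⟩
  have hx' : ∀ i, p (x i) = 0 := congrFun hx
  rw [← Finset.univ_sum_single x]
  exact sum_mem fun i _ => Submodule.smul_top_le_comap_smul_top I
    (LinearMap.single R (fun _ => P) i) (hp.2 (hx' i))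

theorem isMinimalCover_restrictScalars_iff {S : Type*} [CommRing S] [Algebra R S] [Module S P]
    [IsScalarTower R S P] [Module S M] [IsScalarTower R S M] {p : P →ₗ[S] M} :
    IsMinimalCover I (p.restrictScalars R) ↔ IsMinimalCover (I.map (algebraMap R S)) p := by
  refine and_congr Iff.rfl ?_
  rw [← Submodule.restrictScalars_top R S P, ← Ideal.smul_restrictScalars]
  rfl

theorem IsMinimalCover.surjective_of_comp_surjective [Module.Finite R Q] {p : Q →ₗ[R] M}
    (hp : IsMinimalCover I p) (hI : I ≤ Ideal.jacobson ⊥) {f : P →ₗ[R] Q}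
    (hf : Function.Surjective (p ∘ₗ f)) : Function.Surjective f := by
  rw [← LinearMap.range_eq_top, eq_top_iff]
  refine Submodule.le_of_le_smul_of_le_jacobson_bot Module.Finite.fg_top hI fun y _ => ?_
  obtain ⟨x, hx⟩ := hf (p y)
  rw [← add_sub_cancel (f x) y]
  refine Submodule.add_mem_sup ⟨x, rfl⟩ (hp.2 ?_)
  rw [LinearMap.mem_ker, map_sub, ← hx, LinearMap.comp_apply, sub_self]

section Uniqueness

variable [Module.Finite R P] [Module.Projective R P] [Module.Finite R Q] [Module.Projective R Q]
  {p : P →ₗ[R] M} {p' : Q →ₗ[R] M}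

theorem IsMinimalCover.exists_equiv_map_ker (hp : IsMinimalCover I p) (hp' : IsMinimalCover I p')
    (hI : I ≤ Ideal.jacobson ⊥) :
    ∃ e : P ≃ₗ[R] Q, (LinearMap.ker p).map e.toLinearMap = LinearMap.ker p' := by
  obtain ⟨f, hf⟩ := Module.projective_lifting_property p' p hp'.1
  obtain ⟨g, hg⟩ := Module.projective_lifting_property p p' hp.1
  have hf_surj := hp'.surjective_of_comp_surjective hI (hf ▸ hp.1)
  have hg_surj := hp.surjective_of_comp_surjective hI (hg ▸ hp'.1)
  have hgf_inj : Function.Injective (g ∘ₗ f) :=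
    OrzechProperty.injective_of_surjective_endomorphism _ (hg_surj.comp hf_surj)
  refine ⟨LinearEquiv.ofBijective f ⟨.of_comp hgf_inj, hf_surj⟩, ?_⟩
  rw [← hf, LinearMap.ker_comp]
  exact Submodule.map_comap_eq_of_surjective hf_surj _

theorem IsMinimalCover.nonempty_ker_equiv (hp : IsMinimalCover I p) (hp' : IsMinimalCover I p')
    (hI : I ≤ Ideal.jacobson ⊥) : Nonempty (LinearMap.ker p ≃ₗ[R] LinearMap.ker p') := by
  obtain ⟨e, he⟩ := hp.exists_equiv_map_ker hp' hI
  exact ⟨(e.submoduleMap _).trans (LinearEquiv.ofEq _ _ he)⟩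

theorem HasArtinReesOne.of_isMinimalCover (hK : HasArtinReesOne I (LinearMap.ker p))
    (hp : IsMinimalCover I p) (hp' : IsMinimalCover I p') (hI : I ≤ Ideal.jacobson ⊥) :
    HasArtinReesOne I (LinearMap.ker p') := by
  obtain ⟨e, he⟩ := hp.exists_equiv_map_ker hp' hI
  exact he ▸ hK.map_of_comp_eq_id e.symm_comp

end Uniqueness

end MinimalCover

section StrictExact

variable {R : Type*} [CommRing R] {I : Ideal R} {A K M P Q : Type*} [AddCommGroup A] [Module R A]
  [AddCommGroup K] [Module R K] [AddCommGroup M] [Module R M] [AddCommGroup P] [Module R P]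
  [AddCommGroup Q] [Module R Q]

/-- A short exact sequence `0 ⟶ A ⟶ K ⟶ M ⟶ 0` such that the `I`-adic filtration of `K` restricts
to the `I`-adic filtration of `A`. -/
structure IsStrictExact (I : Ideal R) (f : A →ₗ[R] K) (g : K →ₗ[R] M) : Prop where
  injective : Function.Injective f
  exact : Function.Exact f g
  surjective : Function.Surjective g
  strict (q : ℕ) : (I ^ q • ⊤ : Submodule R K).comap f ≤ I ^ q • ⊤

theorem isStrictExact_inl_snd : IsStrictExact I (LinearMap.inl R A M) (LinearMap.snd R A M) where
  injective := LinearMap.inl_injective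
  exact := .inl_snd
  surjective := LinearMap.snd_surjective
  strict q _ ha := Submodule.smul_top_le_comap_smul_top (I ^ q) (LinearMap.fst R A M) ha

section Comp

variable {π : P →ₗ[R] Q} {p : Q →ₗ[R] M}

theorem isStrictExact_ker_comp (hp : IsMinimalCover I p) (hπ : IsMinimalCover I π)
    (hJ : HasArtinReesOne I (LinearMap.ker π)) :
    IsStrictExact I (Submodule.inclusion (LinearMap.ker_le_ker_comp π p))
      (π.restrict (p := LinearMap.ker (p ∘ₗ π)) (q := LinearMap.ker p) fun _ hx => hx) where
  injective := Submodule.inclusion_injective _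
  exact := by
    rintro ⟨x, hx⟩
    constructor
    · intro h
      exact ⟨⟨x, congrArg Subtype.val h⟩, rfl⟩
    · rintro ⟨⟨z, hz⟩, h⟩
      obtain rfl : z = x := congrArg Subtype.val h
      exact Subtype.ext hz
  surjective := by
    rintro ⟨y, hy⟩
    obtain ⟨x, rfl⟩ := hπ.1 y
    exact ⟨⟨x, hy⟩, rfl⟩
  strict := by
    rintro q ⟨x, hx⟩ hxq
    rw [Submodule.mem_comap, Submodule.mem_smul_top_iff] at hxq
    rw [Submodule.mem_smul_top_iff]
    exact hJ q ⟨hx, pow_smul_le_pow_succ_smul_top (hp.comp hπ).2 q hxq⟩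

theorem hasArtinReesOne_ker_comp_iff (hp : IsMinimalCover I p) (hπ : IsMinimalCover I π)
    (hJ : HasArtinReesOne I (LinearMap.ker π)) :
    HasArtinReesOne I (LinearMap.ker (p ∘ₗ π)) ↔ HasArtinReesOne I (LinearMap.ker p) := by
  have hmap : (LinearMap.ker (p ∘ₗ π)).map π = LinearMap.ker p := by
    rw [LinearMap.ker_comp, Submodule.map_comap_eq_of_surjective hπ.1]
  rw [← hmap]
  refine (hasArtinReesOne_map_iff (hp.comp hπ).2 ?_ ?_).symm
  · rwa [inf_eq_right.2 (LinearMap.ker_le_ker_comp π p)]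
  · rintro q y ⟨hy, hyq⟩
    rw [hmap] at hy
    rw [← map_smul_top_of_surjective hπ.1] at hyq
    obtain ⟨x, hx, rfl⟩ := hyq
    exact ⟨x, ⟨hy, hx⟩, rfl⟩

end Comp

namespace IsStrictExact

variable {f : A →ₗ[R] K} {g : K →ₗ[R] M} {p : P →ₗ[R] A} {r : Q →ₗ[R] M} {l : Q →ₗ[R] K}

theorem ker_coprod_le_comap_snd (h : IsStrictExact I f g) (hl : g ∘ₗ l = r) :
    LinearMap.ker ((f ∘ₗ p).coprod l) ≤ (LinearMap.ker r).comap (LinearMap.snd R P Q) := by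
  rintro ⟨x, y⟩ hxy
  have hgxy : g (f (p x) + l y) = 0 := by
    rw [show f (p x) + l y = 0 from hxy, map_zero]
  rwa [map_add, h.exact.apply_apply_eq_zero, zero_add, ← LinearMap.comp_apply, hl] at hgxy

theorem mk_mem_ker_coprod_iff (h : IsStrictExact I f g) {x : P} :
    (x, (0 : Q)) ∈ LinearMap.ker ((f ∘ₗ p).coprod l) ↔ x ∈ LinearMap.ker p := by
  simp [map_eq_zero_iff f h.injective]

theorem exists_mk_mem_ker_coprod (h : IsStrictExact I f g) (hp : Function.Surjective p)
    (hl : g ∘ₗ l = r) (q : ℕ) {y : Q} (hy : y ∈ LinearMap.ker r)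
    (hyq : l y ∈ I ^ q • (⊤ : Submodule R K)) :
    ∃ x ∈ I ^ q • (⊤ : Submodule R P), (x, y) ∈ LinearMap.ker ((f ∘ₗ p).coprod l) := by
  obtain ⟨a, ha⟩ := (h.exact (l y)).1 (by rwa [← hl] at hy)
  have haq : a ∈ I ^ q • (⊤ : Submodule R A) := h.strict q (by rwa [Submodule.mem_comap, ha])
  rw [← map_smul_top_of_surjective hp] at haq
  obtain ⟨x, hx, rfl⟩ := haq
  exact ⟨-x, neg_mem hx, by simp [ha]⟩

theorem isMinimalCover_coprod (h : IsStrictExact I f g) (hp : IsMinimalCover I p)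
    (hr : IsMinimalCover I r) (hl : g ∘ₗ l = r) : IsMinimalCover I ((f ∘ₗ p).coprod l) := by
  constructor
  · intro k
    obtain ⟨y, hy⟩ := hr.1 (g k)
    obtain ⟨a, ha⟩ := (h.exact (k - l y)).1 (by
      rw [map_sub, ← LinearMap.comp_apply, hl, hy, sub_self])
    obtain ⟨x, rfl⟩ := hp.1 a
    exact ⟨(x, y), by simp [ha]⟩
  · rintro ⟨x, y⟩ hxy
    have hy : y ∈ I • (⊤ : Submodule R Q) := hr.2 (h.ker_coprod_le_comap_snd hl hxy)
    have hfpx : f (p x) ∈ I • (⊤ : Submodule R K) := by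
      rw [eq_neg_of_add_eq_zero_left (show f (p x) + l y = 0 from hxy)]
      exact neg_mem (Submodule.smul_top_le_comap_smul_top I l hy)
    have hpx : p x ∈ I • (⊤ : Submodule R A) := by
      simpa using h.strict 1 (by simpa using hfpx)
    rw [← Submodule.mem_comap, hp.comap_smul_top] at hpx
    exact mk_mem_smul_top hpx hy

theorem ker_coprod (h : IsStrictExact I f g) (hp : IsMinimalCover I p) (hr : IsMinimalCover I r)
    (hl : g ∘ₗ l = r) (hA : HasArtinReesOne I (LinearMap.ker p)) :
    IsStrictExact I
      ((LinearMap.inl R P Q).restrict (p := LinearMap.ker p)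
        (q := LinearMap.ker ((f ∘ₗ p).coprod l)) fun _ => h.mk_mem_ker_coprod_iff.2)
      ((LinearMap.snd R P Q).restrict (p := LinearMap.ker ((f ∘ₗ p).coprod l))
        (q := LinearMap.ker r) fun _ hx => h.ker_coprod_le_comap_snd hl hx) where
  injective _ _ hxy :=
    Subtype.ext (LinearMap.inl_injective (congrArg Subtype.val hxy))
  exact := by
    rintro ⟨⟨x, y⟩, hxy⟩
    constructor
    · intro hy
      obtain rfl : y = 0 := congrArg Subtype.val hy
      exact ⟨⟨x, h.mk_mem_ker_coprod_iff.1 hxy⟩, rfl⟩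
    · rintro ⟨z, hz⟩
      rw [← hz]
      rfl
  surjective := by
    rintro ⟨y, hy⟩
    obtain ⟨x, -, hxy⟩ := h.exists_mk_mem_ker_coprod hp.1 hl 0 hy (by simp)
    exact ⟨⟨(x, y), hxy⟩, rfl⟩
  strict := by
    rintro q ⟨x, hx⟩ hxq
    rw [Submodule.mem_comap, Submodule.mem_smul_top_iff] at hxq
    rw [Submodule.mem_smul_top_iff]
    exact hA q ⟨hx, Submodule.smul_top_le_comap_smul_top _ (LinearMap.fst R P Q)
      (pow_smul_le_pow_succ_smul_top (h.isMinimalCover_coprod hp hr hl).2 q hxq)⟩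

theorem hasArtinReesOne_ker_coprod_iff (h : IsStrictExact I f g) (hp : IsMinimalCover I p)
    (hr : IsMinimalCover I r) (hl : g ∘ₗ l = r) (hA : HasArtinReesOne I (LinearMap.ker p)) :
    HasArtinReesOne I (LinearMap.ker ((f ∘ₗ p).coprod l)) ↔
      HasArtinReesOne I (LinearMap.ker r) := by
  have hmap : (LinearMap.ker ((f ∘ₗ p).coprod l)).map (LinearMap.snd R P Q) =
      LinearMap.ker r := by
    refine le_antisymm (Submodule.map_le_iff_le_comap.2 (h.ker_coprod_le_comap_snd hl))
      fun y hy => ?_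
    obtain ⟨x, -, hxy⟩ := h.exists_mk_mem_ker_coprod hp.1 hl 0 hy (by simp)
    exact ⟨(x, y), hxy, rfl⟩
  have hker : LinearMap.ker ((f ∘ₗ p).coprod l) ⊓ LinearMap.ker (LinearMap.snd R P Q) =
      (LinearMap.ker p).map (LinearMap.inl R P Q) := by
    ext ⟨x, y⟩
    constructor
    · rintro ⟨hxy, rfl : y = 0⟩
      exact ⟨x, h.mk_mem_ker_coprod_iff.1 hxy, rfl⟩
    · rintro ⟨z, hz, hzx⟩
      obtain ⟨rfl, rfl⟩ := Prod.ext_iff.1 hzx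
      exact ⟨h.mk_mem_ker_coprod_iff.2 hz, rfl⟩
  rw [← hmap]
  refine (hasArtinReesOne_map_iff (h.isMinimalCover_coprod hp hr hl).2 ?_ ?_).symm
  · rw [hker]
    exact hA.map_of_comp_eq_id (LinearMap.fst_comp_inl R P Q)
  · rintro q y ⟨hy, hyq⟩
    rw [hmap] at hy
    obtain ⟨x, hx, hxy⟩ := h.exists_mk_mem_ker_coprod hp.1 hl (q + 1) hy
      (Submodule.smul_top_le_comap_smul_top _ l hyq)
    exact ⟨(x, y), ⟨hxy, mk_mem_smul_top hx hyq⟩, rfl⟩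

end IsStrictExact

end StrictExact

namespace MinimalFreeResolution

variable {R : Type u} [CommRing R] [IsLocalRing R] {M : Type v} [AddCommGroup M] [Module R M]
  (F : MinimalFreeResolution R M)

section LinearPart

theorem filtration_eq_top {n i : ℕ} (hn : n ≤ i) : F.filtration n i = ⊤ := by
  rw [filtration, Nat.sub_eq_zero_of_le hn, pow_zero, Ideal.one_eq_top, Submodule.top_smul]

theorem filtration_antitone (i : ℕ) : Antitone fun n => F.filtration n i := fun _ _ hmn =>
  Submodule.smul_mono_left (Ideal.pow_le_pow_right (Nat.sub_le_sub_right hmn i))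

theorem map_d_filtration (n i : ℕ) : (F.filtration n (i + 1)).map (F.d i) =
    maximalIdeal R ^ (n - (i + 1)) • LinearMap.range (F.d i) := by
  rw [filtration, Submodule.map_smul'', Submodule.map_top]

theorem hasArtinReesOne_range_d_iff (i : ℕ) :
    HasArtinReesOne (maximalIdeal R) (LinearMap.range (F.d i)) ↔
      ∀ n, LinearMap.range (F.d i) ⊓ F.filtration n i ≤ (F.filtration n (i + 1)).map (F.d i) := by
  have hq : ∀ q, F.filtration (i + q + 1) i = maximalIdeal R ^ (q + 1) • ⊤ ∧
      (F.filtration (i + q + 1) (i + 1)).map (F.d i) =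
        maximalIdeal R ^ q • LinearMap.range (F.d i) := fun q => by
    rw [map_d_filtration, filtration, add_assoc, Nat.add_sub_cancel_left, ← add_assoc,
      Nat.add_sub_add_right, Nat.add_sub_cancel_left]
    exact ⟨rfl, rfl⟩
  constructor
  · intro h n
    rcases le_or_gt n i with hn | hn
    · rw [F.filtration_eq_top (hn.trans i.le_succ), Submodule.map_top]
      exact inf_le_left
    · obtain ⟨q, rfl⟩ := Nat.exists_eq_add_of_lt hn
      rw [(hq q).1, (hq q).2]
      exact h q
  · intro h q
    rw [← (hq q).1, ← (hq q).2]
    exact h (i + q + 1)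

theorem subsingleton_linHomology_succ_iff (i : ℕ) : Subsingleton (F.linHomology (i + 1)) ↔
    ∀ n, LinearMap.ker (F.grD n i) ≤ LinearMap.range (F.grD n (i + 1)) := by
  rw [Submodule.Quotient.subsingleton_iff, Submodule.submoduleOf_eq_top]
  change LinearMap.ker (F.linD i) ≤ LinearMap.range (F.linD (i + 1)) ↔ _
  rw [linD, linD, DirectSum.ker_lmap, DirectSum.range_lmap]
  refine ⟨fun h n z hz => ?_, fun h y hy n _ => h n (hy n trivial)⟩
  classical
  have hcycle : DirectSum.lof R ℕ (fun n => F.gr n (i + 1)) n z ∈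
      (Submodule.pi Set.univ fun n => LinearMap.ker (F.grD n i)).comap
        (DirectSum.coeFnLinearMap R) := by
    intro k _
    by_cases hk : k = n
    · subst hk
      simpa using hz
    · simp [DirectSum.lof_eq_of, DirectSum.of_eq_of_ne _ _ _ hk]
  simpa using h hcycle n trivial

theorem ker_grD_le_range_grD_iff (n i : ℕ) :
    LinearMap.ker (F.grD n i) ≤ LinearMap.range (F.grD n (i + 1)) ↔
      ∀ x ∈ F.filtration n (i + 1), F.d i x ∈ F.filtration (n + 1) i →
        ∃ y ∈ F.filtration n (i + 2), x - F.d (i + 1) y ∈ F.filtration (n + 1) (i + 1) := by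
  have hker : ∀ x : F.filtration n (i + 1), F.grD n i (Submodule.Quotient.mk x) = 0 ↔
      F.d i x ∈ F.filtration (n + 1) i := fun x =>
    Submodule.Quotient.mk_eq_zero ((F.filtration (n + 1) i).submoduleOf (F.filtration n i))
  have hrange : ∀ (x : F.filtration n (i + 1)) (y : F.filtration n (i + 2)),
      Submodule.Quotient.mk x = F.grD n (i + 1) (Submodule.Quotient.mk y) ↔
        (x : Fin (F.rank (i + 1)) → R) - F.d (i + 1) y ∈ F.filtration (n + 1) (i + 1) :=
    fun x y => Submodule.Quotient.eq
      ((F.filtration (n + 1) (i + 1)).submoduleOf (F.filtration n (i + 1)))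
  constructor
  · intro h x hx hdx
    obtain ⟨y, hy⟩ := h ((hker ⟨x, hx⟩).2 hdx)
    obtain ⟨y, rfl⟩ := Submodule.Quotient.mk_surjective _ y
    exact ⟨y, y.2, (hrange ⟨x, hx⟩ y).1 hy.symm⟩
  · intro h x hx
    obtain ⟨x, rfl⟩ := Submodule.Quotient.mk_surjective _ x
    obtain ⟨y, hy, hxy⟩ := h x x.2 ((hker x).1 hx)
    exact ⟨Submodule.Quotient.mk ⟨y, hy⟩, ((hrange x ⟨y, hy⟩).2 hxy).symm⟩

theorem hasArtinReesOne_range_d_of_subsingleton {i : ℕ}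
    (h : Subsingleton (F.linHomology (i + 1))) :
    HasArtinReesOne (maximalIdeal R) (LinearMap.range (F.d i)) := by
  rw [hasArtinReesOne_range_d_iff]
  rintro n _ ⟨⟨x, rfl⟩, hx⟩
  suffices ∀ m ≤ n, ∃ z ∈ F.filtration m (i + 1), F.d i z = F.d i x from this n le_rfl
  intro m hm
  induction m with
  | zero => exact ⟨x, by rw [F.filtration_eq_top (Nat.zero_le _)]; trivial, rfl⟩
  | succ m ih =>
    obtain ⟨z, hz, hzx⟩ := ih (by omega)
    have hdz : F.d i z ∈ F.filtration (m + 1) i := hzx ▸ F.filtration_antitone i hm hx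
    obtain ⟨y, -, hy⟩ := (F.ker_grD_le_range_grD_iff m i).1
      (F.subsingleton_linHomology_succ_iff i |>.1 h m) z hz hdz
    exact ⟨z - F.d (i + 1) y, hy,
      by rw [map_sub, (F.exact_succ i).apply_apply_eq_zero, sub_zero, hzx]⟩

theorem subsingleton_linHomology_succ {i : ℕ}
    (hi : HasArtinReesOne (maximalIdeal R) (LinearMap.range (F.d i)))
    (hi' : HasArtinReesOne (maximalIdeal R) (LinearMap.range (F.d (i + 1)))) :
    Subsingleton (F.linHomology (i + 1)) := by
  rw [hasArtinReesOne_range_d_iff] at hi hi'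
  refine (F.subsingleton_linHomology_succ_iff i).2 fun n =>
    (F.ker_grD_le_range_grD_iff n i).2 fun x hx hdx => ?_
  obtain ⟨w, hw, hwx⟩ := hi (n + 1) ⟨⟨x, rfl⟩, hdx⟩
  have hxw : x - w ∈ LinearMap.range (F.d (i + 1)) :=
    (F.exact_succ i (x - w)).1 (by rw [map_sub, hwx, sub_self])
  obtain ⟨y, hy, hyx⟩ :=
    hi' n ⟨hxw, sub_mem hx (F.filtration_antitone (i + 1) n.le_succ hw)⟩
  exact ⟨y, hy, by rwa [hyx, sub_sub_cancel]⟩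

theorem forall_subsingleton_linHomology_iff (d : ℕ) :
    (∀ i, d < i → Subsingleton (F.linHomology i)) ↔
      ∀ j, d ≤ j → HasArtinReesOne (maximalIdeal R) (LinearMap.range (F.d j)) := by
  constructor
  · intro h j hj
    exact F.hasArtinReesOne_range_d_of_subsingleton (h (j + 1) (Nat.lt_succ_of_le hj))
  · rintro h (_ | i) hi
    · exact absurd hi (Nat.not_lt_zero d)
    · exact F.subsingleton_linHomology_succ (h i (Nat.le_of_lt_succ hi)) (h (i + 1) hi.le)

end LinearPart

section Constructions

/-- Transport of a minimal free resolution along an isomorphism. -/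
def congr {M' : Type w} [AddCommGroup M'] [Module R M'] (e : M ≃ₗ[R] M') :
    MinimalFreeResolution R M' where
  rank := F.rank
  d := F.d
  aug := e.toLinearMap ∘ₗ F.aug
  aug_surjective := e.surjective.comp F.aug_surjective
  exact_zero := LinearMap.exact_iff.2 <| by
    rw [LinearEquiv.ker_comp]
    exact LinearMap.exact_iff.1 F.exact_zero
  exact_succ := F.exact_succ
  minimal := F.minimal

theorem ker_aug : LinearMap.ker F.aug = LinearMap.range (F.d 0) :=
  LinearMap.exact_iff.1 F.exact_zero

theorem isMinimalCover_aug : IsMinimalCover (maximalIdeal R) F.aug :=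
  ⟨F.aug_surjective, F.ker_aug.trans_le (F.minimal 0)⟩

/-- The minimal free resolution of the first syzygy obtained by dropping `F 0`. -/
def shift : MinimalFreeResolution R (LinearMap.ker F.aug) where
  rank n := F.rank (n + 1)
  d n := F.d (n + 1)
  aug := (F.d 0).codRestrict _ F.exact_zero.apply_apply_eq_zero
  aug_surjective := by
    rintro ⟨x, hx⟩
    obtain ⟨y, hy⟩ := (F.exact_zero x).1 hx
    exact ⟨y, Subtype.ext hy⟩
  exact_zero := LinearMap.exact_iff.2 <|
    (LinearMap.ker_codRestrict _ _ _).trans (LinearMap.exact_iff.1 (F.exact_succ 0))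
  exact_succ n := F.exact_succ (n + 1)
  minimal n := F.minimal (n + 1)

/-- The minimal free resolution of `M` obtained by splicing a minimal free cover of `M` with a
minimal free resolution of its kernel. -/
def splice {b : ℕ} {p : (Fin b → R) →ₗ[R] M} (hp : IsMinimalCover (maximalIdeal R) p)
    (G : MinimalFreeResolution R (LinearMap.ker p)) : MinimalFreeResolution R M where
  rank
    | 0 => b
    | n + 1 => G.rank n
  d
    | 0 => (LinearMap.ker p).subtype ∘ₗ G.aug
    | n + 1 => G.d n
  aug := p
  aug_surjective := hp.1
  exact_zero := LinearMap.exact_iff.2 <| by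
    rw [LinearMap.range_comp, LinearMap.range_eq_top.2 G.aug_surjective, Submodule.map_top,
      Submodule.range_subtype]
  exact_succ
    | 0 => LinearMap.exact_iff.2 <| by
      rw [LinearMap.ker_comp, Submodule.ker_subtype, Submodule.comap_bot]
      exact G.ker_aug
    | n + 1 => G.exact_succ n
  minimal
    | 0 => (LinearMap.range_comp_le_range _ _).trans ((Submodule.range_subtype _).trans_le hp.2)
    | n + 1 => G.minimal n

end Constructions

end MinimalFreeResolution

section LinearAt

variable {R : Type u} [CommRing R] [IsLocalRing R] {M : Type v} [AddCommGroup M] [Module R M]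

/-- The image of `F (j + 1) ⟶ F j` satisfies the Artin–Rees condition. All minimal free
resolutions `F` of `M` are allowed, as they are isomorphic. Equivalently, the maps
`Torⱼ₊₁ (R ⧸ 𝔪 ^ (q + 1), M) ⟶ Torⱼ₊₁ (R ⧸ 𝔪 ^ q, M)` vanish for all `q`. -/
def IsLinearAt (R : Type u) [CommRing R] [IsLocalRing R] (j : ℕ)
    (M : Type v) [AddCommGroup M] [Module R M] : Prop :=
  ∀ F : MinimalFreeResolution R M,
    HasArtinReesOne (maximalIdeal R) (LinearMap.range (F.d j))

/-- Koszul modules, defined by the Artin–Rees condition on all their syzygies; by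
`lind_eq_zero_iff` this is the vanishing of the linearity defect. -/
def IsKoszul (R : Type u) [CommRing R] [IsLocalRing R]
    (M : Type v) [AddCommGroup M] [Module R M] : Prop :=
  ∀ j, IsLinearAt R j M

theorem lind_le_iff (d : ℕ) : lind R M ≤ d ↔ ∀ j, d ≤ j → IsLinearAt R j M := by
  rw [lind, sSup_le_iff]
  constructor
  · intro h j hj F
    refine (F.forall_subsingleton_linHomology_iff d).1 (fun i hi => ?_) j hj
    by_contra hne
    have hid : (i : ℕ∞) ≤ d := h i ⟨F, i, not_subsingleton_iff_nontrivial.1 hne, rfl⟩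
    exact hi.not_ge (by exact_mod_cast hid)
  · rintro h _ ⟨F, i, hne, rfl⟩
    by_contra! hi
    have := (F.forall_subsingleton_linHomology_iff d).2 (fun j hj => h j hj F) i
      (by exact_mod_cast hi)
    exact not_subsingleton _ this

theorem lind_eq_zero_iff : lind R M = 0 ↔ IsKoszul R M := by
  simpa [IsKoszul] using lind_le_iff (R := R) (M := M) 0

theorem lind_eq_lind_of_forall_isLinearAt_iff {S : Type*} [CommRing S] [IsLocalRing S]
    {N : Type*} [AddCommGroup N] [Module S N] (h : ∀ j, IsLinearAt R j M ↔ IsLinearAt S j N) :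
    lind R M = lind S N := by
  refine WithTop.eq_of_forall_le_coe_iff fun d : ℕ => ?_
  change lind R M ≤ (d : ℕ∞) ↔ lind S N ≤ (d : ℕ∞)
  simp only [lind_le_iff, h]

theorem IsLinearAt.congr {M' : Type w} [AddCommGroup M'] [Module R M'] {j : ℕ}
    (h : IsLinearAt R j M) (e : M ≃ₗ[R] M') : IsLinearAt R j M' :=
  fun F => h (F.congr e.symm)

theorem isLinearAt_congr {M' : Type w} [AddCommGroup M'] [Module R M'] {j : ℕ} (e : M ≃ₗ[R] M') :
    IsLinearAt R j M ↔ IsLinearAt R j M' :=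
  ⟨fun h => h.congr e, fun h => h.congr e.symm⟩

theorem lind_congr {M' : Type w} [AddCommGroup M'] [Module R M'] (e : M ≃ₗ[R] M') :
    lind R M = lind R M' :=
  lind_eq_lind_of_forall_isLinearAt_iff fun _ => isLinearAt_congr e

section DimensionShift

variable [IsNoetherianRing R] {P : Type w} [AddCommGroup P] [Module R P] [Module.Finite R P]
  [Module.Projective R P] {p : P →ₗ[R] M}

theorem IsMinimalCover.isLinearAt_zero_iff (hp : IsMinimalCover (maximalIdeal R) p) :
    IsLinearAt R 0 M ↔ HasArtinReesOne (maximalIdeal R) (LinearMap.ker p) := by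
  have := Module.Finite.of_surjective p hp.1
  constructor
  · intro h
    obtain ⟨F⟩ := nonempty_minimalFreeResolution R M
    have hF := h F
    rw [← F.ker_aug] at hF
    exact hF.of_isMinimalCover F.isMinimalCover_aug hp (maximalIdeal_le_jacobson ⊥)
  · intro h F
    rw [← F.ker_aug]
    exact h.of_isMinimalCover hp F.isMinimalCover_aug (maximalIdeal_le_jacobson ⊥)

theorem IsMinimalCover.isLinearAt_succ_iff (hp : IsMinimalCover (maximalIdeal R) p) (j : ℕ) :
    IsLinearAt R (j + 1) M ↔ IsLinearAt R j (LinearMap.ker p) := by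
  have := Module.Finite.of_surjective p hp.1
  constructor
  · intro h F
    obtain ⟨G⟩ := nonempty_minimalFreeResolution R M
    obtain ⟨e⟩ := hp.nonempty_ker_equiv G.isMinimalCover_aug (maximalIdeal_le_jacobson ⊥)
    exact h (.splice G.isMinimalCover_aug (F.congr e))
  · intro h F
    obtain ⟨e⟩ := F.isMinimalCover_aug.nonempty_ker_equiv hp (maximalIdeal_le_jacobson ⊥)
    exact h (F.shift.congr e)

theorem IsKoszul.ker (hM : IsKoszul R M) (hp : IsMinimalCover (maximalIdeal R) p) :
    IsKoszul R (LinearMap.ker p) :=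
  fun j => (hp.isLinearAt_succ_iff j).1 (hM (j + 1))

end DimensionShift

end LinearAt

section KoszulExtension

variable {R : Type u} [CommRing R] [IsLocalRing R]

theorem exists_isMinimalCover (M : Type*) [AddCommGroup M] [Module R M] [Module.Finite R M] :
    ∃ (b : ℕ) (p : (Fin b → R) →ₗ[R] M), IsMinimalCover (maximalIdeal R) p :=
  exists_minimal_cover R M

variable [IsNoetherianRing R]

namespace IsStrictExact

variable {A K M : Type*} [AddCommGroup A] [Module R A] [Module.Finite R A] [AddCommGroup K]
  [Module R K] [AddCommGroup M] [Module R M] [Module.Finite R M] {f : A →ₗ[R] K} {g : K →ₗ[R] M}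

theorem isLinearAt_zero_iff (h : IsStrictExact (maximalIdeal R) f g) (hA : IsLinearAt R 0 A) :
    IsLinearAt R 0 K ↔ IsLinearAt R 0 M := by
  obtain ⟨a, p, hp⟩ := exists_isMinimalCover (R := R) A
  obtain ⟨c, r, hr⟩ := exists_isMinimalCover (R := R) M
  obtain ⟨l, hl⟩ := Module.projective_lifting_property g r h.surjective
  rw [(h.isMinimalCover_coprod hp hr hl).isLinearAt_zero_iff, hr.isLinearAt_zero_iff]
  exact h.hasArtinReesOne_ker_coprod_iff hp hr hl (hp.isLinearAt_zero_iff.1 hA)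

theorem exists_isStrictExact_ker (h : IsStrictExact (maximalIdeal R) f g)
    (hA : IsLinearAt R 0 A) :
    ∃ (a c : ℕ) (p : (Fin a → R) →ₗ[R] A) (k : (Fin a → R) × (Fin c → R) →ₗ[R] K)
      (r : (Fin c → R) →ₗ[R] M) (f' : LinearMap.ker p →ₗ[R] LinearMap.ker k)
      (g' : LinearMap.ker k →ₗ[R] LinearMap.ker r),
      IsMinimalCover (maximalIdeal R) p ∧ IsMinimalCover (maximalIdeal R) k ∧
        IsMinimalCover (maximalIdeal R) r ∧ IsStrictExact (maximalIdeal R) f' g' := by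
  obtain ⟨a, p, hp⟩ := exists_isMinimalCover (R := R) A
  obtain ⟨c, r, hr⟩ := exists_isMinimalCover (R := R) M
  obtain ⟨l, hl⟩ := Module.projective_lifting_property g r h.surjective
  exact ⟨a, c, p, _, r, _, _, hp, h.isMinimalCover_coprod hp hr hl, hr,
    h.ker_coprod hp hr hl (hp.isLinearAt_zero_iff.1 hA)⟩

end IsStrictExact

-- The induction replaces modules by syzygies, which live in the universe of `R`.
theorem IsStrictExact.isLinearAt_iff_of_universe_eq (j : ℕ) : ∀ {A K M : Type u} [AddCommGroup A]
    [Module R A] [Module.Finite R A] [AddCommGroup K] [Module R K] [AddCommGroup M] [Module R M]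
    [Module.Finite R M] {f : A →ₗ[R] K} {g : K →ₗ[R] M},
    IsStrictExact (maximalIdeal R) f g → IsKoszul R A →
      (IsLinearAt R j K ↔ IsLinearAt R j M) := by
  induction j with
  | zero => exact fun h hA => h.isLinearAt_zero_iff (hA 0)
  | succ j ih =>
    intro A K M _ _ _ _ _ _ _ _ f g h hA
    obtain ⟨a, c, p, k, r, f', g', hp, hk, hr, h'⟩ := h.exists_isStrictExact_ker (hA 0)
    rw [hk.isLinearAt_succ_iff, hr.isLinearAt_succ_iff]
    exact ih h' (hA.ker hp)

variable {A B : Type*} [AddCommGroup A] [Module R A] [Module.Finite R A] [AddCommGroup B]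
  [Module R B] [Module.Finite R B]

theorem IsStrictExact.isLinearAt_iff {K : Type*} [AddCommGroup K] [Module R K]
    {f : A →ₗ[R] K} {g : K →ₗ[R] B} (h : IsStrictExact (maximalIdeal R) f g) (hA : IsKoszul R A)
    (j : ℕ) : IsLinearAt R j K ↔ IsLinearAt R j B := by
  cases j with
  | zero => exact h.isLinearAt_zero_iff (hA 0)
  | succ j =>
    obtain ⟨a, c, p, k, r, f', g', hp, hk, hr, h'⟩ := h.exists_isStrictExact_ker (hA 0)
    rw [hk.isLinearAt_succ_iff, hr.isLinearAt_succ_iff]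
    exact h'.isLinearAt_iff_of_universe_eq j (hA.ker hp)

theorem IsLinearAt.of_subsingleton {M : Type*} [AddCommGroup M] [Module R M] [Subsingleton M]
    (j : ℕ) : IsLinearAt R j M := by
  suffices h : IsLinearAt R j (Fin 0 → R) from h.congr (LinearEquiv.ofSubsingleton _ _)
  have hp : IsMinimalCover (maximalIdeal R) (LinearMap.id : (Fin 0 → R) →ₗ[R] (Fin 0 → R)) :=
    ⟨Function.surjective_id, LinearMap.ker_id.trans_le bot_le⟩
  induction j with
  | zero =>
    exact hp.isLinearAt_zero_iff.2 fun q => by simp only [LinearMap.ker_id, bot_inf_eq, bot_le]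
  | succ j ih => exact (hp.isLinearAt_succ_iff j).2 (ih.congr (LinearEquiv.ofSubsingleton _ _))

theorem IsKoszul.prod (hA : IsKoszul R A) (hB : IsKoszul R B) : IsKoszul R (A × B) :=
  fun j => (isStrictExact_inl_snd.isLinearAt_iff hA j).2 (hB j)

theorem IsKoszul.pi (hA : IsKoszul R A) (n : ℕ) : IsKoszul R (Fin n → A) := by
  induction n with
  | zero => exact IsLinearAt.of_subsingleton
  | succ n ih => exact fun j => (hA.prod ih j).congr (Fin.consLinearEquiv R fun _ => A)

end KoszulExtension

section BaseChange

section Algebra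

variable {R : Type*} [CommRing R] {S : Type*} [CommRing S] [Algebra R S]

theorem finite_of_surjective_algebraMap (hsurj : Function.Surjective (algebraMap R S))
    (N : Type*) [AddCommGroup N] [Module R N] [Module S N] [IsScalarTower R S N]
    [Module.Finite S N] : Module.Finite R N :=
  have : Module.Finite R S := Module.Finite.of_surjective (Algebra.linearMap R S) hsurj
  Module.Finite.trans S N

theorem isMinimalCover_algebraLinearMap [IsLocalRing R] [Nontrivial S]
    (hsurj : Function.Surjective (algebraMap R S)) :
    IsMinimalCover (maximalIdeal R) (Algebra.linearMap R S) := by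
  refine ⟨hsurj, ?_⟩
  rw [smul_eq_mul, Ideal.mul_top]
  exact le_maximalIdeal (RingHom.ker_ne_top (algebraMap R S))

end Algebra

variable {R : Type u} [CommRing R] [IsLocalRing R] [IsNoetherianRing R]
  {S : Type v} [CommRing S] [IsLocalRing S] [IsNoetherianRing S] [Algebra R S]

-- The recursion replaces `N` by its syzygy, which lives in the universe of `S`.
theorem IsKoszul.isLinearAt_iff_of_universe_eq (hS : IsKoszul R S)
    (hsurj : Function.Surjective (algebraMap R S)) (j : ℕ) (N : Type v) [AddCommGroup N]
    [Module R N] [Module S N] [IsScalarTower R S N] [Module.Finite S N] :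
    IsLinearAt R j N ↔ IsLinearAt S j N := by
  have := finite_of_surjective_algebraMap hsurj S
  have hmap := map_maximalIdeal_of_surjective (algebraMap R S) hsurj
  obtain ⟨b, p, hp⟩ := exists_isMinimalCover (R := S) N
  have hpR : IsMinimalCover (maximalIdeal R) (p.restrictScalars R) := by
    rwa [isMinimalCover_restrictScalars_iff, hmap]
  have hπ := (isMinimalCover_algebraLinearMap hsurj).compLeft (Fin b)
  have hπ_ker := hπ.isLinearAt_zero_iff.1 (hS.pi b 0)
  cases j with
  | zero =>
    rw [(hpR.comp hπ).isLinearAt_zero_iff, hp.isLinearAt_zero_iff,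
      hasArtinReesOne_ker_comp_iff hpR hπ hπ_ker, ← hmap, ← hasArtinReesOne_restrictScalars_iff]
    rfl
  | succ j =>
    have := finite_of_surjective_algebraMap hsurj (LinearMap.ker p)
    rw [(hpR.comp hπ).isLinearAt_succ_iff, hp.isLinearAt_succ_iff,
      ← hS.isLinearAt_iff_of_universe_eq hsurj j]
    exact (isStrictExact_ker_comp hpR hπ hπ_ker).isLinearAt_iff ((hS.pi b).ker hπ) j

theorem lind_eq_lind_of_isKoszul (hS : IsKoszul R S)
    (hsurj : Function.Surjective (algebraMap R S)) (N : Type*) [AddCommGroup N] [Module R N]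
    [Module S N] [IsScalarTower R S N] [Module.Finite S N] : lind R N = lind S N := by
  obtain ⟨n, p, hp⟩ := Module.Finite.exists_fin' S N
  let e := p.quotKerEquivOfSurjective hp
  rw [← lind_congr e, ← lind_congr (e.restrictScalars R)]
  exact lind_eq_lind_of_forall_isLinearAt_iff fun j => hS.isLinearAt_iff_of_universe_eq hsurj j _

theorem IsKoszul.exists_module_lind_eq (hS : IsKoszul R S)
    (hsurj : Function.Surjective (algebraMap R S)) (N : Type*) [AddCommGroup N] [Module S N]
    [Module.Finite S N] : ∃ _ : Module R N, Module.Finite R N ∧ lind R N = lind S N := by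
  let _ : Module R N := Module.compHom N (algebraMap R S)
  have : IsScalarTower R S N := IsScalarTower.of_compHom R S N
  exact ⟨_, finite_of_surjective_algebraMap hsurj N, lind_eq_lind_of_isKoszul hS hsurj N⟩

end BaseChange

section Universe

variable {R : Type u} [CommRing R] [IsLocalRing R] (M : Type*) [AddCommGroup M] [Module R M]
  [Module.Finite R M]

theorem lind_le_glind : lind R M ≤ glind R := by
  have := Module.Finite.small.{u} R M
  rw [← lind_congr (Shrink.linearEquiv R M)]
  exact le_sSup ⟨ModuleCat.of R (Shrink.{u} M), inferInstanceAs (Module.Finite R (Shrink M)), rfl⟩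

theorem IsAbsolutelyKoszul.lind_lt_top (hR : IsAbsolutelyKoszul R) : lind R M < ⊤ := by
  have := Module.Finite.small.{u} R M
  rw [← lind_congr (Shrink.linearEquiv R M)]
  exact hR (Shrink.{u} M) inferInstance

end Universe

end LinearityDefect

theorem theorem5p2 {R : Type*} {S : Type*}
    [CommRing R] [IsLocalRing R] [IsNoetherianRing R]
    [CommRing S] [IsLocalRing S] [IsNoetherianRing S]
    [Algebra R S] (hsurj : Function.Surjective (algebraMap R S))
    (hS : LinearityDefect.lind R S = 0) :
    (∀ (N : Type*) [AddCommGroup N] [Module R N] [Module S N] [IsScalarTower R S N],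
      Module.Finite S N → LinearityDefect.lind R N = LinearityDefect.lind S N) ∧
    LinearityDefect.glind S ≤ LinearityDefect.glind R ∧
    (LinearityDefect.IsAbsolutelyKoszul R → LinearityDefect.IsAbsolutelyKoszul S) := by
  have hS' := LinearityDefect.lind_eq_zero_iff.1 hS
  refine ⟨fun N _ _ _ _ _ => LinearityDefect.lind_eq_lind_of_isKoszul hS' hsurj N, sSup_le ?_,
    fun hR N _ _ _ => ?_⟩
  · rintro _ ⟨N, hN, rfl⟩
    obtain ⟨_, _, hlind⟩ := hS'.exists_module_lind_eq hsurj N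
    exact hlind ▸ LinearityDefect.lind_le_glind N
  · obtain ⟨_, _, hlind⟩ := hS'.exists_module_lind_eq hsurj N
    exact hlind ▸ hR.lind_lt_top N
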